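/- **Setting.** Real variables: the position $(r,h)$ (horizontal, vertical) of an intruder aircraft relative to the ownship, the relative vertical velocity $v$, a timer $t$; the constants $r_p,h_p$ (puck radius and height), $r_v$ (horizontal rate of closure), $a_{lo},a_{up},a_{max},c,\varepsilon$; an advisory $(w,v_{lo},v_{up})$; the accelerations $a_o$ (ownship), $a_i$ (intruder) and an estimate $c_o$. Put, for $w=\pm1$, $$T_{lo}(v,w,v_{lo})=\tfrac{\max(0,w(v_{lo}-v))}{a_{lo}},\qquad T_{up}(v,w,v_{up})=\tfrac{\max(0,w(v_{up}-v))}{a_{up}}.$$ Let $A_{lo}(v,w,v_{lo},h_n,t)$ mean: ($0\le t<T_{lo}$ and $h_n=\frac{wa_{lo}}2t^2+vt$) or ($t\ge T_{lo}$ and $h_n=v_{lo}t-\frac{w\max(0,w(v_{lo}-v))^2}{2a_{lo}}$). Let $A_{up}(v,w,v_{up},h_n,t)$ mean: ($0\le t<T_{up}$ and $h_n=\frac{wa_{up}}2t^2+vt$) or ($t\ge T_{up}$ and $h_n=w\max(wv_{up},wv)t-\frac{w\max(0,w(v_{up}-v))^2}{2a_{up}}$). * $L^{-1}(r,h,v,w,v_{lo})$: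 for all $t,h_n$ with $A_{lo}(v,w,v_{lo},h_n,t)$, $|r-r_vt|>r_p$ or $w(h_n-h)>h_p$. * $L^{\varepsilon}(r,h,v,w,v_{lo})$: the same for all such $t,h_n$ with ($t\le\varepsilon$ or $\varepsilon<0$) only. * $U^{\varepsilon}(r,h,v,w,v_{up})$: for all $t,h_n$ with ($t\le\varepsilon$ or $\varepsilon<0$) and $A_{up}(v,w,v_{up},h_n,t)$, $|r-r_vt|>r_p$ or $w(h-h_n)>h_p$. * $L^{safeable}(r,h,v,w,v_{lo})$: $L^{\varepsilon}(r,h,v,w,v_{lo})$ holds, and for all $h',v'$ such that ($0\le\varepsilon<T_{lo}$, $h'=\frac{wa_{lo}}2\varepsilon^2+v\varepsilon$, $v'=wa_{lo}\varepsilon+v$) or ($\varepsilon\ge T_{lo}$, $h'=v'\varepsilon-\frac{w\max(0,w(v_{lo}-v))^2}{2a_{lo}}$, $v'=v_{lo}$) there is $v_{lo}'$ with $L^{-1}(r-r_v\varepsilon,h-h',v',w,v_{lo}')$. * $U^{safeable}(r,h,v,w,v_{up})$: $U^{\varepsilon}(r,h,v,w,v_{up})$ holds, and for all $h',v'$ such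 that ($0\le\varepsilon<T_{up}$, $h'=\frac{wa_{up}}2\varepsilon^2+v\varepsilon$, $v'=wa_{up}\varepsilon+v$) or ($\varepsilon\ge T_{up}$, $h'=v'\varepsilon-\frac{w\max(0,w(v_{up}-v))^2}{2a_{up}}$, $v'=w\max(wv_{up},wv)$) there is $v_{up}'$ with $L^{-1}(r-r_v\varepsilon,h-h',v',-w,v_{up}')$. * $C^{safeable}(r,h,v,w,v_{lo},v_{up})$: $wv_{lo}\le wv_{up}$, and $L^{safeable}(r,h,v,w,v_{lo})$ or $U^{safeable}(r,h,v,w,v_{up})$. **The game.** The opponent (intruder and environment) repeats the following encounter any number of times. (1) It sets $w:=1$ or $w:=-1$ and picks any real $v_{lo},v_{up}$ such that $C^{safeable}(r,h,v,w,v_{lo},v_{up})$ holds in the current state (otherwise it loses); the advisory $(w,v_{lo},v_{up})$ is announced. (2) $t:=0$. (3) Any number of times, as the opponent decides: the ownship picks an estimate $c_o\ge0$; then, any number of times, as the opponent decides: the ownship picks $a_o\in[-a_{max},a_{max}]$; then, any number of times, as the opponent decides: the opponent picks $a_i$ with $-c_o<a_i<c_o$ (otherwise it loses), picks one of the three domains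 $wv\le wv_{lo}$, $wv_{lo}\le wv\le wv_{up}$, $wv_{up}\le wv$, and lets the state follow $r'=-r_v,\ h'=-v,\ v'=a_o-a_i,\ t'=1$ for any duration during which $t\le\varepsilon$ and the chosen domain condition hold throughout. The ownship wins for an objective $X$ if, whenever the opponent stops repeating the encounter, $X$ holds or the opponent has lost in one of its choices. Winning is in the sense of differential game logic (dGL), where the winning region of a loop is a greatest fixpoint. **Theorem.** Assume $r_p\ge0$, $h_p>0$, $r_v\ge0$, $c>0$, $a_{lo}>0$, $w\in\{-1,1\}$, $a_{up}>a_{lo}+2c$, $a_{max}\ge a_{lo}+c$, $\varepsilon\ge0$, and $C^{safeable}(r,h,v,w,v_{lo},v_{up})$ in the initial state. Then: 1. The ownship has a winning strategy for the objective $|r|>r_p\lor|h|>h_p$ (no near mid-air collision, NMAC); that is, the corresponding dGL formula (assumptions $\rightarrow$ [game] no NMAC) is valid. 2. Moreover, the ownship has a winning strategy that always uses the worst-case estimate $c_o=c$ and only the accelerations $a_o\in\{w(a_{lo}+c),\,0,\,-wc\}$, which ensures no NMAC and also that a safe follow-up advisory exists: whenever the game stops, there are $w'\in\{-1,1\}$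 and $v_{lo}',v_{up}'$ with $C^{safeable}(r,h,v,w',v_{lo}',v_{up}')$ and $L^{-1}(r,h,v,w',v_{lo}')$ in the state reached. -/

import Mathlib

namespace ACASX

/-! ### Differential game logic

Terms and first-order formulas are represented by their values on states; hybrid games are
syntax trees, and the box modality is given by the winning region of the player who faces
the modality `[·]` (Demon; here: the ownship, who acts inside the dual operator). -/

/-- The variables of the encounter: horizontal and vertical separation `r`, `h` of the intruder
relative to the ownship, relative vertical velocity `v`, puck sizes `rp`, `hp`, horizontal rate of
closure `rv`, advisory `w`, `vlo`, `vup` and its announced copy `advW`, `advLo`, `advUp`,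
accelerations `ao` (ownship) and `ai` (intruder), the bounds `alo`, `aup`, `amax`, `c`,
the ownship's estimate `co` of the intruder's acceleration, the time bound `eps`, the timer `t`. -/
inductive Var where
  | r | h | v | t
  | rp | hp | rv | alo | aup | amax | c | eps
  | w | vlo | vup | advW | advLo | advUp
  | co | ao | ai
  deriving DecidableEq

/-- States assign a real number to every variable. -/
abbrev State : Type := Var → ℝ

/-- Formulas, identified with the set of states in which they are true. -/
abbrev Formula : Type := Set State

/-- A formula is valid if it is true in all states. -/
def Valid (φ : Formula) : Prop := ∀ s : State, s ∈ φ

/-- Hybrid games. In `ode f Q` the variables follow the differential equation `x' = f x` within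
the evolution domain `Q`; variables that do not occur in the differential equation get the
right-hand side `0`. -/
inductive Game where
  | assign (x : Var) (e : State → ℝ)
  | assignAny (x : Var)
  | test (Q : Formula)
  | ode (f : State → Var → ℝ) (Q : Formula)
  | choice (α β : Game)
  | seq (α β : Game)
  | loop (α : Game)
  | dual (α : Game)

/-- `φ` solves `x' = f x` on `[0, T]` from `s` and stays in the evolution domain `Q`. -/
def IsSolution (f : State → Var → ℝ) (Q : Formula) (s : State) (T : ℝ) (φ : ℝ → State) : Prop :=
  φ 0 = s ∧
  ∀ τ ∈ Set.Icc (0 : ℝ) T,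
    (∀ x : Var, HasDerivWithinAt (fun σ => φ σ x) (f (φ τ) x) (Set.Icc 0 T) τ) ∧ φ τ ∈ Q

/-- The winning region of Demon in the game `α` for the objective `X`. Outside dual operators the
opponent resolves assignments `x := *`, durations of differential equations, choices, and
the number of repetitions of loops, and loses when failing a test; the dual operator
swaps the players. The winning region of a loop is a greatest fixpoint. -/
def demonWins : Game → Set State → Set State
  | .assign x e, X => {s | Function.update s x (e s) ∈ X}
  | .assignAny x, X => {s | ∀ a : ℝ, Function.update s x a ∈ X}
  | .test Q, X => {s | s ∈ Q → s ∈ X}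
  | .ode f Q, X => {s | ∀ (T : ℝ) (φ : ℝ → State), 0 ≤ T → IsSolution f Q s T φ → φ T ∈ X}
  | .choice α β, X => demonWins α X ∩ demonWins β X
  | .seq α β, X => demonWins α (demonWins β X)
  | .loop α, X => ⋃₀ {Z | Z ⊆ X ∩ demonWins α Z}
  | .dual α, X => (demonWins α Xᶜ)ᶜ

/-- The formula `[α] P`. -/
def box (α : Game) (P : Formula) : Formula := demonWins α P

/-- The formula `P → Q`. -/
def imp (P Q : Formula) : Formula := {s | s ∈ P → s ∈ Q}

infixr:60 " ;; " => Game.seq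
infixr:55 " ⊔⊔ " => Game.choice

/-! ### Safe regions

The first argument `s` of each region supplies the constants `rp, hp, rv, alo, aup, eps`. -/

noncomputable section

def Tlo (s : State) (v w vlo : ℝ) : ℝ := max 0 (w * (vlo - v)) / s .alo

def Alo (s : State) (v w vlo hn t : ℝ) : Prop :=
  (0 ≤ t ∧ t < Tlo s v w vlo ∧ hn = w * s .alo / 2 * t ^ 2 + v * t) ∨
  (t ≥ Tlo s v w vlo ∧ hn = vlo * t - w * (max 0 (w * (vlo - v))) ^ 2 / (2 * s .alo))

/-- Lower-bounded infinite-time safe region. -/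
def LInf (s : State) (r h v w vlo : ℝ) : Prop :=
  ∀ t rn hn : ℝ, rn = s .rv * t ∧ Alo s v w vlo hn t →
    |r - rn| > s .rp ∨ w * (hn - h) > s .hp

def Tup (s : State) (v w vup : ℝ) : ℝ := max 0 (w * (vup - v)) / s .aup

def Aup (s : State) (v w vup hn t : ℝ) : Prop :=
  (0 ≤ t ∧ t < Tup s v w vup ∧ hn = w * s .aup / 2 * t ^ 2 + v * t) ∨
  (t ≥ Tup s v w vup ∧
    hn = w * max (w * vup) (w * v) * t - w * (max 0 (w * (vup - v))) ^ 2 / (2 * s .aup))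

/-- Lower-bounded bounded-time safe region. -/
def LEps (s : State) (r h v w vlo : ℝ) : Prop :=
  ∀ t rn hn : ℝ, (t ≤ s .eps ∨ s .eps < 0) ∧ rn = s .rv * t ∧ Alo s v w vlo hn t →
    |r - rn| > s .rp ∨ w * (hn - h) > s .hp

/-- Upper-bounded bounded-time safe region. -/
def UEps (s : State) (r h v w vup : ℝ) : Prop :=
  ∀ t rn hn : ℝ, (t ≤ s .eps ∨ s .eps < 0) ∧ rn = s .rv * t ∧ Aup s v w vup hn t →
    |r - rn| > s .rp ∨ w * (h - hn) > s .hp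

/-- Lower-bounded safeable region. -/
def LSafeable (s : State) (r h v w vlo : ℝ) : Prop :=
  LEps s r h v w vlo ∧
  ∀ hex vex : ℝ,
    ((0 ≤ s .eps ∧ s .eps < Tlo s v w vlo ∧
        hex = w * s .alo / 2 * (s .eps) ^ 2 + v * s .eps ∧ vex = w * s .alo * s .eps + v) ∨
      (s .eps ≥ Tlo s v w vlo ∧
        hex = vex * s .eps - w * (max 0 (w * (vlo - v))) ^ 2 / (2 * s .alo) ∧ vex = vlo)) →
    ∃ vloex : ℝ, LInf s (r - s .rv * s .eps) (h - hex) vex w vloex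

/-- Upper-bounded safeable region; the follow-up advisory is a reversal. -/
def USafeable (s : State) (r h v w vup : ℝ) : Prop :=
  UEps s r h v w vup ∧
  ∀ hex vex : ℝ,
    ((0 ≤ s .eps ∧ s .eps < Tup s v w vup ∧
        hex = w * s .aup / 2 * (s .eps) ^ 2 + v * s .eps ∧ vex = w * s .aup * s .eps + v) ∨
      (s .eps ≥ Tup s v w vup ∧
        hex = vex * s .eps - w * (max 0 (w * (vup - v))) ^ 2 / (2 * s .aup) ∧
        vex = w * max (w * vup) (w * v))) →
    ∃ vupex : ℝ, LInf s (r - s .rv * s .eps) (h - hex) vex (-w) vupex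

/-- Two-sided safeable region. -/
def CSafeable (s : State) (r h v w vlo vup : ℝ) : Prop :=
  w * vlo ≤ w * vup ∧ (LSafeable s r h v w vlo ∨ USafeable s r h v w vup)

/-! ### The encounter with a vertically maneuvering intruder -/

/-- The current advisory is safeable in the current state. -/
def safeable : Formula := {s | CSafeable s (s .r) (s .h) (s .v) (s .w) (s .vlo) (s .vup)}

def init : Formula :=
  {s | s .rp ≥ 0 ∧ s .hp > 0 ∧ s .rv ≥ 0 ∧ s .c > 0 ∧ s .alo > 0 ∧ (s .w = -1 ∨ s .w = 1) ∧
    s .aup > s .alo + 2 * s .c ∧ s .amax ≥ s .alo + s .c ∧ s .eps ≥ 0}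

/-- No near mid-air collision. -/
def notNMAC : Formula := {s | |s .r| > s .rp ∨ |s .h| > s .hp}

/-- Any safeable advisory may be issued. -/
def advisory : Game :=
  (.assign .w (fun _ => 1) ⊔⊔ .assign .w (fun _ => -1)) ;;
  .assignAny .vlo ;; .assignAny .vup ;; .test safeable ;;
  .assign .advW (fun s => s .w) ;; .assign .advLo (fun s => s .vlo) ;;
  .assign .advUp (fun s => s .vup)

def intruder : Game := .assignAny .ai ;; .test {s | -s .co < s .ai ∧ s .ai < s .co}

/-- `r' = -rv, h' = -v, v' = ao - ai, t' = 1`. -/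
def motionField (s : State) : Var → ℝ
  | .r => -s .rv
  | .h => -s .v
  | .v => s .ao - s .ai
  | .t => 1
  | _ => 0

/-- A choice between differential equations that differ in their evolution domains only. -/
def motion : Game :=
  .ode motionField {s | s .t ≤ s .eps ∧ s .w * s .v ≤ s .w * s .vlo} ⊔⊔
  .ode motionField {s | s .t ≤ s .eps ∧
    s .w * s .vlo ≤ s .w * s .v ∧ s .w * s .v ≤ s .w * s .vup} ⊔⊔
  .ode motionField {s | s .t ≤ s .eps ∧ s .w * s .vup ≤ s .w * s .v}

/-- The encounter, for given moves of the ownship: its estimate of the intruder's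
acceleration and its own acceleration. -/
def encounter (estimate ownship : Game) : Game :=
  .loop (advisory ;; .assign .t (fun _ => 0) ;;
    .loop (estimate ;; .loop (ownship ;; .loop (intruder ;; motion))))

/-- The ownship picks any estimate `co ≥ 0`. -/
def estimate : Game := .dual (.assignAny .co ;; .test {s | s .co ≥ 0})

/-- The ownship picks any acceleration within its limits. -/
def ownship : Game :=
  .dual (.assignAny .ao ;; .test {s | -s .amax ≤ s .ao ∧ s .ao ≤ s .amax})

/-- The formula: from every initial state in the safeable region the ownship has a winning
strategy to avoid near mid-air collisions. -/
def safeableVert : Formula :=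
  imp (init ∩ safeable) (box (encounter estimate ownship) notNMAC)

/-- The ownship is committed to the worst-case estimate `co = c`. -/
def worstCaseEstimate : Game :=
  .dual (.assignAny .co ;; .test {s | s .co ≥ 0 ∧ s .co = s .c})

/-- The ownship is committed to the accelerations `w (alo + c)`, `0`, `-w c`
(and still to its limits). -/
def strategicOwnship : Game :=
  .dual (.assignAny .ao ;; .test {s | (-s .amax ≤ s .ao ∧ s .ao ≤ s .amax) ∧
    (s .ao = s .w * (s .alo + s .c) ∨ s .ao = 0 ∨ s .ao = -(s .w * s .c))})

/-- In the current state some advisory may be issued that is safeable and, moreover, safe forever. -/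
def followUp : Formula :=
  {s | ∃ w vlo vup : ℝ, (w = 1 ∨ w = -1) ∧
    CSafeable s (s .r) (s .h) (s .v) w vlo vup ∧ LInf s (s .r) (s .h) (s .v) w vlo}

/-- The formula for the committed ownship, with a safe follow-up advisory at all times. -/
def safeableVertStrategic : Formula :=
  imp (init ∩ safeable)
    (box (encounter worstCaseEstimate strategicOwnship) (notNMAC ∩ followUp))

end

end ACASX

/-! The advisory regions are compared with two extremal trajectories, measured along `w`.
`LSafeable` implies `LoSafe`, since nothing climbs above acceleration `alo` kept forever;
`USafeable` implies `UpSafe`, since the upper trajectory is never behind constant velocity and its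
follow-up is a reversal.

Neither condition mentions `vlo` or `vup`, and each is kept by one fixed acceleration. As `|ai| <
c`, the choice `ao = w (alo + c)` gives `w (ao - ai) ≥ alo`, which preserves `LoSafe`
(`LoSafe.motion`); `ao = -w c` gives `w (ao - ai) ≤ 0`, which preserves `UpSafe` with its delay
running down as `eps - t` (`UpSafe.motion`). The acceleration `0` is never needed.

Either condition yields `LoSafe` in direction `w` or `-w`. At time `0` this excludes an NMAC, and
`LoSafe.exists_lInf` turns it into a follow-up advisory. `encounter_wins` assembles nested loop
invariants. -/

namespace ACASX

/-! ### Safety of extremal trajectories -/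

/-- Accelerating by `w * alo` forever avoids the puck. -/
def LoSafe (s : State) (r h v w : ℝ) : Prop :=
  ∀ t : ℝ, 0 ≤ t → |r - s .rv * t| > s .rp ∨ w * v * t + s .alo / 2 * t ^ 2 - w * h > s .hp

/-- Keeping the velocity for time `δ` and accelerating by `-w * alo` from then on avoids the
puck. -/
def UpSafe (s : State) (r h v w δ : ℝ) : Prop :=
  ∀ t : ℝ, 0 ≤ t → |r - s .rv * t| > s .rp ∨
    w * h - w * v * t + s .alo / 2 * (max 0 (t - δ)) ^ 2 > s .hp

/-- The position, in the direction of the advisory, of the trajectory that accelerates by `a`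
from velocity `u` to velocity `U`. -/
noncomputable def loPos (a u U t : ℝ) : ℝ :=
  if t < max 0 (U - u) / a then a / 2 * t ^ 2 + u * t else U * t - max 0 (U - u) ^ 2 / (2 * a)

/-- For `u ≤ U`, the gap after reaching `U` is the perfect square `(a t - (U - u))² / (2a)`. -/
lemma loPos_le {a u U t : ℝ} (ha : 0 < a) (ht : 0 ≤ t) : loPos a u U t ≤ u * t + a / 2 * t ^ 2 := by
  unfold loPos
  split_ifs with h
  · linarith
  · rcases le_total (U - u) 0 with h0 | h0
    · rw [max_eq_left h0]
      have : 0 ≤ a / 2 * t ^ 2 := by positivity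
      have : 0 ≤ (u - U) * t := mul_nonneg (by linarith) ht
      norm_num
      linarith
    · rw [max_eq_right h0]
      have h1 : u * t + a / 2 * t ^ 2 - (U * t - (U - u) ^ 2 / (2 * a))
          = (a * t - (U - u)) ^ 2 / (2 * a) := by field_simp; ring
      have : 0 ≤ (a * t - (U - u)) ^ 2 / (2 * a) := by positivity
      linarith

lemma mul_self_of_sign {w : ℝ} (hw : w = -1 ∨ w = 1) : w * w = 1 := by
  rcases hw with rfl | rfl <;> norm_num

/-- Measuring along `w` and using `w * w = 1` merges the two signs of the advisory. -/
lemma lInf_iff {s : State} (ha : 0 < s .alo) {r h v w vlo : ℝ} (hw : w = -1 ∨ w = 1) :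
    LInf s r h v w vlo ↔ ∀ t : ℝ, 0 ≤ t →
      |r - s .rv * t| > s .rp ∨ loPos (s .alo) (w * v) (w * vlo) t - w * h > s .hp := by
  have hw2 := mul_self_of_sign hw
  have hT : Tlo s v w vlo = max 0 (w * vlo - w * v) / s .alo := by unfold Tlo; ring_nf
  have hT0 : 0 ≤ Tlo s v w vlo := div_nonneg (le_max_left _ _) ha.le
  have hm : w * (vlo - v) = w * vlo - w * v := by ring
  constructor
  · intro H t ht
    by_cases h1 : t < Tlo s v w vlo
    · refine (H t _ _ ⟨rfl, .inl ⟨ht, h1, rfl⟩⟩).imp id fun h2 => ?_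
      rw [loPos, if_pos (hT ▸ h1)]
      linear_combination h2 + (s .alo / 2 * t ^ 2) * hw2
    · refine (H t _ _ ⟨rfl, .inr ⟨not_lt.1 h1, rfl⟩⟩).imp id fun h2 => ?_
      rw [loPos, if_neg (hT ▸ h1)]
      rw [hm] at h2
      linear_combination h2 - (max 0 (w * vlo - w * v) ^ 2 / (2 * s .alo)) * hw2
  · rintro H t _ hn ⟨rfl, ⟨h0, h1, rfl⟩ | ⟨h1, rfl⟩⟩
    · refine (H t h0).imp id fun h2 => ?_
      rw [loPos, if_pos (hT ▸ h1)] at h2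
      linear_combination h2 - (s .alo / 2 * t ^ 2) * hw2
    · refine (H t (hT0.trans h1)).imp id fun h2 => ?_
      rw [loPos, if_neg (hT ▸ not_lt.2 h1)] at h2
      rw [hm]
      linear_combination h2 + (max 0 (w * vlo - w * v) ^ 2 / (2 * s .alo)) * hw2

lemma LInf.loSafe {s : State} (ha : 0 < s .alo) {r h v w vlo : ℝ} (hw : w = -1 ∨ w = 1)
    (H : LInf s r h v w vlo) : LoSafe s r h v w := fun t ht =>
  ((lInf_iff ha hw).1 H t ht).imp id fun h2 => by
    have := loPos_le (u := w * v) (U := w * vlo) ha ht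
    linarith

lemma LoSafe.exists_lInf {s : State} (ha : 0 < s .alo) (hrv : 0 ≤ s .rv)
    {r h v w : ℝ} (hw : w = -1 ∨ w = 1) (H : LoSafe s r h v w) :
    ∃ vlo, LInf s r h v w vlo := by
  have hw2 := mul_self_of_sign hw
  suffices ∃ U : ℝ, ∀ t : ℝ, 0 ≤ t →
      |r - s .rv * t| > s .rp ∨ loPos (s .alo) (w * v) U t - w * h > s .hp by
    obtain ⟨U, hU⟩ := this
    refine ⟨w * U, (lInf_iff ha hw).2 ?_⟩
    rwa [← mul_assoc, hw2, one_mul]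
  rcases hrv.eq_or_lt with hrv | hrv
  -- With `rv = 0` the horizontal distance is constant, so it suffices never to fall below the
  -- lowest point of the parabola: keep a nonnegative velocity, brake a negative one to zero.
  · refine ⟨max (w * v) 0, fun t ht => ?_⟩
    unfold LoSafe at H
    rw [← hrv] at H ⊢
    unfold loPos
    split_ifs with h1
    · exact (H t ht).imp id fun h2 => by linarith
    · rcases le_total 0 (w * v) with h0 | h0
      · refine (H 0 le_rfl).imp (by simp) fun h2 => ?_
        have := mul_nonneg h0 ht
        simp only [max_eq_left h0]
        norm_num at h2 ⊢
        linarith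
      -- The vertex of the parabola, where the velocity along `w` vanishes.
      · refine (H (-(w * v) / s .alo) (div_nonneg (by linarith) ha.le)).imp (by simp) fun h2 => ?_
        simp only [max_eq_right h0]
        rw [max_eq_right (by linarith)]
        have h3 : w * v * (-(w * v) / s .alo) + s .alo / 2 * (-(w * v) / s .alo) ^ 2
            = 0 * t - (0 - w * v) ^ 2 / (2 * s .alo) := by field_simp; ring
        linarith
  -- From time `B` on the puck has been passed horizontally. The target below is the velocity
  -- reached exactly at `B`, so the parabola is followed until then.
  · set B := (|r| + |s .rp|) / s .rv + 1 with hB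
    have hB0 : 0 < B := by positivity
    refine ⟨w * v + s .alo * B, fun t ht => ?_⟩
    have hT : max 0 (w * v + s .alo * B - w * v) / s .alo = B := by
      rw [max_eq_right (by rw [add_sub_cancel_left]; positivity)]
      field_simp
      ring
    by_cases h1 : t < B
    · rw [loPos, if_pos (by rwa [hT])]
      exact (H t ht).imp id fun h2 => by linarith
    · left
      have h2 : s .rv * B ≤ s .rv * t := mul_le_mul_of_nonneg_left (not_lt.1 h1) hrv.le
      have h3 : s .rv * B = |r| + |s .rp| + s .rv := by rw [hB]; field_simp
      have h4 := neg_abs_le (r - s .rv * t)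
      have h5 := le_abs_self r
      have h6 := le_abs_self (s .rp)
      linarith

lemma LInf.lSafeable {s : State} (ha : 0 < s .alo) (hrv : 0 ≤ s .rv) (he : 0 ≤ s .eps)
    {r h v w vlo : ℝ} (hw : w = -1 ∨ w = 1) (H : LInf s r h v w vlo) :
    LSafeable s r h v w vlo := by
  have hw2 := mul_self_of_sign hw
  refine ⟨fun t rn hn ht => H t rn hn ht.2, ?_⟩
  rintro hex vex (⟨-, h1, rfl, rfl⟩ | ⟨h1, rfl, rfl⟩)
  · refine LoSafe.exists_lInf ha hrv hw fun t ht => ?_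
    refine (H.loSafe ha hw (s .eps + t) (by linarith)).imp (fun h2 => ?_) fun h2 => ?_
    · rwa [mul_add, ← sub_sub] at h2
    · linear_combination h2 + (- s .alo * s .eps * t - s .alo / 2 * s .eps ^ 2) * hw2
  -- Here `vlo` is already reached; coasting at `vlo` is safe, and accelerating further only adds
  -- separation.
  · refine LoSafe.exists_lInf ha hrv hw fun t ht => ?_
    refine (H (s .eps + t) _ _ ⟨rfl, .inr ⟨by linarith, rfl⟩⟩).imp (fun h2 => ?_) fun h2 => ?_
    · rwa [mul_add, ← sub_sub] at h2
    · have : 0 ≤ s .alo / 2 * t ^ 2 := by positivity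
      linear_combination h2 + this

lemma LSafeable.loSafe {s : State} (ha : 0 < s .alo) (he : 0 ≤ s .eps)
    {r h v w vlo : ℝ} (hw : w = -1 ∨ w = 1) (H : LSafeable s r h v w vlo) :
    LoSafe s r h v w := by
  have hw2 := mul_self_of_sign hw
  have hm : w * (vlo - v) = w * vlo - w * v := by ring
  intro t ht
  rcases le_total t (s .eps) with hte | hte
  · by_cases h1 : t < Tlo s v w vlo
    · refine (H.1 t _ _ ⟨.inl hte, rfl, .inl ⟨ht, h1, rfl⟩⟩).imp id fun h2 => ?_
      linear_combination h2 + (s .alo / 2 * t ^ 2) * hw2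
    · refine (H.1 t _ _ ⟨.inl hte, rfl, .inr ⟨not_lt.1 h1, rfl⟩⟩).imp id fun h2 => ?_
      have h3 := loPos_le (u := w * v) (U := w * vlo) ha ht
      rw [loPos, if_neg (by rw [← hm]; exact h1), ← hm] at h3
      linear_combination h2 + h3 - (max 0 (w * (vlo - v)) ^ 2 / (2 * s .alo)) * hw2
  -- After `eps` the follow-up takes over; its extremal trajectory must lie below the original
  -- parabola.
  · have key : ∀ hex vex : ℝ, LoSafe s (r - s .rv * s .eps) (h - hex) vex w →
        w * hex + w * vex * (t - s .eps) + s .alo / 2 * (t - s .eps) ^ 2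
          ≤ w * v * t + s .alo / 2 * t ^ 2 →
        |r - s .rv * t| > s .rp ∨ w * v * t + s .alo / 2 * t ^ 2 - w * h > s .hp := by
      intro hex vex h1 h2
      refine (h1 (t - s .eps) (by linarith)).imp (fun h3 => ?_) fun h3 => by linarith
      rwa [sub_sub, ← mul_add, add_sub_cancel] at h3
    by_cases h1 : s .eps < Tlo s v w vlo
    · obtain ⟨V, hV⟩ := H.2 _ _ (.inl ⟨he, h1, rfl, rfl⟩)
      refine key _ _ (hV.loSafe ha hw) (le_of_eq ?_)
      linear_combination (s .alo * s .eps * t - s .alo / 2 * s .eps ^ 2) * hw2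
    · obtain ⟨V, hV⟩ := H.2 _ _ (.inr ⟨not_lt.1 h1, rfl, rfl⟩)
      refine key _ _ (hV.loSafe ha hw) ?_
      have h1 := not_lt.1 h1
      unfold Tlo at h1
      have e : w * (vlo * s .eps - w * max 0 (w * (vlo - v)) ^ 2 / (2 * s .alo))
          = w * vlo * s .eps - max 0 (w * (vlo - v)) ^ 2 / (2 * s .alo) := by
        linear_combination (-max 0 (w * (vlo - v)) ^ 2 / (2 * s .alo)) * hw2
      rw [e]
      rw [hm] at h1 ⊢
      rcases le_total (w * vlo - w * v) 0 with h0 | h0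
      · rw [max_eq_left h0]
        have h3 : 0 ≤ s .alo / 2 * (t ^ 2 - (t - s .eps) ^ 2) :=
          mul_nonneg (by linarith) (by nlinarith)
        have h4 : 0 ≤ (w * v - w * vlo) * t := mul_nonneg (by linarith) ht
        norm_num
        linarith
      · rw [max_eq_right h0] at h1 ⊢
        rw [div_le_iff₀ ha] at h1
        have h2 : w * v * t + s .alo / 2 * t ^ 2
            - (w * vlo * s .eps - (w * vlo - w * v) ^ 2 / (2 * s .alo)
              + w * vlo * (t - s .eps) + s .alo / 2 * (t - s .eps) ^ 2)
            = ((s .alo * t - (w * vlo - w * v)) ^ 2 - (s .alo * (t - s .eps)) ^ 2)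
              / (2 * s .alo) := by field_simp; ring
        have h3 : 0 ≤ s .alo * (t - s .eps) := mul_nonneg ha.le (by linarith)
        -- Since `eps` is past the switching time, `alo * eps ≥ w vlo - w v`.
        have h4 : (s .alo * (t - s .eps)) ^ 2 ≤ (s .alo * t - (w * vlo - w * v)) ^ 2 :=
          pow_le_pow_left₀ h3 (by linarith) 2
        have h5 := div_nonneg (sub_nonneg.2 h4) (by linarith : 0 ≤ 2 * s .alo)
        linarith

/-- The expression is the distance gained over constant velocity by speeding up by `m` at rate `a`.
-/
lemma sub_sq_div_nonneg {a m t : ℝ} (ha : 0 < a) (hm : 0 ≤ m) (ht : m / a ≤ t) :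
    0 ≤ m * t - m ^ 2 / (2 * a) := by
  have h1 : m * (m / a) ≤ m * t := mul_le_mul_of_nonneg_left ht hm
  have h2 : m ^ 2 / (2 * a) = m * (m / a) / 2 := by field_simp
  have h3 : 0 ≤ m * (m / a) := by positivity
  linarith

lemma USafeable.upSafe {s : State} (hlo : 0 < s .alo) (ha : 0 < s .aup) (he : 0 ≤ s .eps)
    {r h v w vup : ℝ} (hw : w = -1 ∨ w = 1) (H : USafeable s r h v w vup) :
    UpSafe s r h v w (s .eps) := by
  have hw2 := mul_self_of_sign hw
  have hw' : -w = -1 ∨ -w = 1 := by rcases hw with rfl | rfl <;> norm_num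
  set m := max 0 (w * (vup - v)) with hm
  have hm0 : 0 ≤ m := le_max_left _ _
  have hM : max (w * vup) (w * v) = w * v + m := by
    rw [hm, ← max_add_add_left, max_comm]; congr 1 <;> ring
  intro t ht
  rcases le_total t (s .eps) with hte | hte
  · rw [max_eq_left (by linarith)]
    by_cases h1 : t < Tup s v w vup
    · refine (H.1 t _ _ ⟨.inl hte, rfl, .inl ⟨ht, h1, rfl⟩⟩).imp id fun h2 => ?_
      have : 0 ≤ s .aup / 2 * t ^ 2 := by positivity
      linear_combination h2 + this - (s .aup / 2 * t ^ 2) * hw2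
    · refine (H.1 t _ _ ⟨.inl hte, rfl, .inr ⟨not_lt.1 h1, rfl⟩⟩).imp id fun h2 => ?_
      have h3 := sub_sq_div_nonneg ha hm0 (not_lt.1 h1)
      rw [hM] at h2
      linear_combination h2 + h3 - ((w * v + m) * t - m ^ 2 / (2 * s .aup)) * hw2
  · rw [max_eq_right (by linarith)]
    -- The reversal starts at `eps` from a point and velocity at least as far along `w` as constant
    -- velocity would give.
    have key : ∀ hex vex : ℝ, LoSafe s (r - s .rv * s .eps) (h - hex) vex (-w) →
        w * v * t ≤ w * hex + w * vex * (t - s .eps) →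
        |r - s .rv * t| > s .rp ∨
          w * h - w * v * t + s .alo / 2 * (t - s .eps) ^ 2 > s .hp := by
      intro hex vex h1 h2
      refine (h1 (t - s .eps) (by linarith)).imp (fun h3 => ?_) fun h3 => by linarith
      rwa [sub_sub, ← mul_add, add_sub_cancel] at h3
    by_cases h1 : s .eps < Tup s v w vup
    · obtain ⟨V, hV⟩ := H.2 _ _ (.inl ⟨he, h1, rfl, rfl⟩)
      refine key _ _ (hV.loSafe hlo hw') ?_
      have h2 : 0 ≤ s .aup / 2 * s .eps ^ 2 := by positivity
      have h3 : 0 ≤ s .aup * s .eps * (t - s .eps) :=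
        mul_nonneg (by positivity) (by linarith)
      linear_combination h2 + h3
        - (s .aup * s .eps * (t - s .eps) + s .aup / 2 * s .eps ^ 2) * hw2
    · obtain ⟨V, hV⟩ := H.2 _ _ (.inr ⟨not_lt.1 h1, rfl, rfl⟩)
      refine key _ _ (hV.loSafe hlo hw') ?_
      have h3 := sub_sq_div_nonneg ha hm0 (not_lt.1 h1)
      have h4 : 0 ≤ m * (t - s .eps) := mul_nonneg hm0 (by linarith)
      rw [hM]
      linear_combination h3 + h4
        - ((w * v + m) * t - m ^ 2 / (2 * s .aup)) * hw2

/-- Reversing at once separates at least as much as reversing after the delay. -/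
lemma UpSafe.loSafe_neg {s : State} (ha : 0 < s .alo) {r h v w δ : ℝ} (hδ : 0 ≤ δ)
    (H : UpSafe s r h v w δ) : LoSafe s r h v (-w) := fun t ht =>
  (H t ht).imp id fun h2 => by
    have h3 : max 0 (t - δ) ^ 2 ≤ t ^ 2 :=
      pow_le_pow_left₀ (le_max_left _ _) (max_le ht (by linarith)) 2
    have h4 := mul_le_mul_of_nonneg_left h3 (by linarith : 0 ≤ s .alo / 2)
    linarith

/-! ### Invariance of the extremal conditions under motion -/

lemma LoSafe.motion {s : State} {r h v w d T : ℝ} (hT : 0 ≤ T) (hd : s .alo ≤ w * d)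
    (H : LoSafe s r h v w) :
    LoSafe s (r - s .rv * T) (h - v * T - d / 2 * T ^ 2) (v + d * T) w := fun t ht =>
  (H (T + t) (by linarith)).imp (fun h2 => by rwa [mul_add, ← sub_sub] at h2) fun h2 => by
    -- The gap between the extremal trajectory from the new state at time `t` and the old one at
    -- time `T + t`.
    have h3 : 0 ≤ (w * d - s .alo) * (T * t + T ^ 2 / 2) :=
      mul_nonneg (by linarith) (by positivity)
    linear_combination h2 + h3

lemma UpSafe.motion {s : State} {r h v w d δ T : ℝ} (hT : 0 ≤ T) (hd : w * d ≤ 0)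
    (H : UpSafe s r h v w δ) :
    UpSafe s (r - s .rv * T) (h - v * T - d / 2 * T ^ 2) (v + d * T) w (δ - T) := fun t ht =>
  (H (T + t) (by linarith)).imp (fun h2 => by rwa [mul_add, ← sub_sub] at h2) fun h2 => by
    have h3 : 0 ≤ (-(w * d)) * (T * t + T ^ 2 / 2) :=
      mul_nonneg (by linarith) (by positivity)
    rw [show t - (δ - T) = T + t - δ by ring]
    linear_combination h2 + h3

/-! ### Solutions of the differential equation -/

lemma eq_of_hasDerivWithinAt {f g : ℝ → ℝ} {f' : ℝ → ℝ} {T : ℝ} (hT : 0 ≤ T)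
    (hf : ∀ x ∈ Set.Icc 0 T, HasDerivWithinAt f (f' x) (Set.Icc 0 T) x)
    (hg : ∀ x, HasDerivAt g (f' x) x) (h0 : f 0 = g 0) {x : ℝ} (hx : x ∈ Set.Icc 0 T) :
    f x = g x := by
  have h := (convex_Icc 0 T).norm_image_sub_le_of_norm_hasDerivWithin_le (C := 0)
    (f := fun x => f x - g x) (f' := fun _ => 0)
    (fun y hy => ((hf y hy).sub (hg y).hasDerivWithinAt).congr_deriv (sub_self _)) (by simp)
    (Set.left_mem_Icc.2 hT) hx
  simp only [zero_mul, norm_le_zero_iff] at h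
  linarith

/-- The state reached from `s` after time `T`. -/
noncomputable def motionState (s : State) (T : ℝ) : State
  | .r => s .r - s .rv * T
  | .h => s .h - s .v * T - (s .ao - s .ai) / 2 * T ^ 2
  | .v => s .v + (s .ao - s .ai) * T
  | .t => s .t + T
  | x => s x

/-- The system is triangular: constants, then `v`, then `h`. Each component is found by integration,
so no general ODE uniqueness is involved. -/
lemma IsSolution.eq_motionState {Q : Formula} {s : State} {T : ℝ} {φ : ℝ → State} (hT : 0 ≤ T)
    (H : IsSolution motionField Q s T φ) : φ T = motionState s T := by
  obtain ⟨h0, H⟩ := H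
  have hc : ∀ x, (∀ q, motionField q x = 0) → ∀ τ ∈ Set.Icc 0 T, φ τ x = s x := by
    intro x hx τ hτ
    refine eq_of_hasDerivWithinAt (f := fun τ => φ τ x) (f' := fun _ => 0) (g := fun _ => s x) hT (fun y hy => ?_)
      (fun y => hasDerivAt_const _ _) (by rw [h0]) hτ
    have := (H y hy).1 x
    rwa [hx] at this
  have hv : ∀ τ ∈ Set.Icc 0 T, φ τ .v = s .v + (s .ao - s .ai) * τ := by
    intro τ hτ
    refine eq_of_hasDerivWithinAt (f := fun τ => φ τ .v) (f' := fun _ => s .ao - s .ai)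
      (g := fun τ => s .v + (s .ao - s .ai) * τ) hT (fun y hy => ?_)
      (fun y => ?_) (by simp [h0]) hτ
    · have := (H y hy).1 .v
      simpa only [motionField, hc .ao (fun _ => rfl) y hy, hc .ai (fun _ => rfl) y hy] using this
    · simpa using ((hasDerivAt_id y).const_mul (s .ao - s .ai)).const_add (s .v)
  have hTT : T ∈ Set.Icc 0 T := Set.right_mem_Icc.2 hT
  funext x
  have hx := hc x
  cases x <;> first
    | exact hx (fun _ => rfl) T hTT
    | exact hv T hTT
    | skip
  · refine eq_of_hasDerivWithinAt (f := fun τ => φ τ .r) (f' := fun _ => -s .rv)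
      (g := fun τ => s .r - s .rv * τ) hT (fun y hy => ?_) (fun y => ?_) (by simp [h0]) hTT
    · have := (H y hy).1 .r
      simpa only [motionField, hc .rv (fun _ => rfl) y hy] using this
    · simpa using ((hasDerivAt_id y).const_mul (s .rv)).const_sub (s .r)
  · refine eq_of_hasDerivWithinAt (f := fun τ => φ τ .h)
      (f' := fun τ => -(s .v + (s .ao - s .ai) * τ))
      (g := fun τ => s .h - s .v * τ - (s .ao - s .ai) / 2 * τ ^ 2)
      hT (fun y hy => ?_) (fun y => ?_) (by simp [h0]) hTT
    · have := (H y hy).1 .h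
      simpa only [motionField, hv y hy] using this
    · have := (((hasDerivAt_id y).const_mul (s .v)).const_sub (s .h)).sub
        ((hasDerivAt_pow 2 y).const_mul ((s .ao - s .ai) / 2))
      refine this.congr_deriv ?_
      push_cast
      ring
  · refine eq_of_hasDerivWithinAt (f := fun τ => φ τ .t) (f' := fun _ => 1)
      (g := fun τ => s .t + τ) hT (fun y hy => (H y hy).1 .t) (fun y => ?_) (by simp [h0]) hTT
    exact (hasDerivAt_id y).const_add _

/-! ### Invariants of the encounter -/

/-- Between any two moves of an encounter, one of the two safe trajectories is available. -/
def maneuverSafe : Formula :=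
  {s | s ∈ init ∧ s .t ≤ s .eps ∧
    (LoSafe s (s .r) (s .h) (s .v) (s .w) ∨
      UpSafe s (s .r) (s .h) (s .v) (s .w) (s .eps - s .t))}

/-- The ownship follows one of the two safe trajectories or is on the safe side of it. -/
def maneuvering : Formula :=
  {s | s ∈ init ∧ s .t ≤ s .eps ∧ s .co = s .c ∧
    (s .ao = s .w * (s .alo + s .c) ∧ LoSafe s (s .r) (s .h) (s .v) (s .w) ∨
      s .ao = -(s .w * s .c) ∧ UpSafe s (s .r) (s .h) (s .v) (s .w) (s .eps - s .t))}

lemma LoSafe.mem_notNMAC {s : State} {w : ℝ} (hw : w = -1 ∨ w = 1)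
    (H : LoSafe s (s .r) (s .h) (s .v) w) : s ∈ notNMAC := by
  refine (H 0 le_rfl).imp (by simp) fun h => ?_
  rcases hw with rfl | rfl
  · exact lt_of_lt_of_le (by linarith) (le_abs_self (s .h))
  · exact lt_of_lt_of_le (by linarith) (neg_le_abs (s .h))

lemma LoSafe.mem_followUp {s : State} (hs : s ∈ init) {w : ℝ} (hw : w = -1 ∨ w = 1)
    (H : LoSafe s (s .r) (s .h) (s .v) w) : s ∈ followUp := by
  obtain ⟨-, -, hrv, -, ha, -, -, -, he⟩ := hs
  obtain ⟨V, hV⟩ := H.exists_lInf ha hrv hw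
  exact ⟨w, V, V, hw.symm, ⟨le_rfl, .inl (hV.lSafeable ha hrv he hw)⟩, hV⟩

lemma maneuverSafe_subset : maneuverSafe ⊆ init ∩ (notNMAC ∩ followUp) := by
  rintro s ⟨hs, ht, H⟩
  obtain ⟨w, hw, h⟩ : ∃ w : ℝ, (w = -1 ∨ w = 1) ∧ LoSafe s (s .r) (s .h) (s .v) w := by
    obtain ⟨-, -, -, -, ha, hw, -, -, -⟩ := hs
    rcases H with H | H
    · exact ⟨_, hw, H⟩
    · refine ⟨-s .w, ?_, H.loSafe_neg ha (by linarith)⟩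
      rcases hw with hw | hw <;> rw [hw] <;> norm_num
  exact ⟨hs, h.mem_notNMAC hw, h.mem_followUp hs hw⟩

lemma maneuverSafe_of_safeable {s : State} (hs : s ∈ init) (H : s ∈ safeable) (ht : s .t = 0) :
    s ∈ maneuverSafe := by
  obtain ⟨-, -, -, hc, ha, hw, hup, -, he⟩ := id hs
  refine ⟨hs, by rwa [ht], H.2.imp (fun h => h.loSafe ha he hw) fun h => ?_⟩
  rw [ht, sub_zero]
  exact h.upSafe ha (by linarith) he hw

lemma maneuvering_motionState {s : State} {T : ℝ} (hT : 0 ≤ T) (hs : s ∈ maneuvering)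
    (hlo : -s .co < s .ai) (hup : s .ai < s .co) (ht : motionState s T .t ≤ s .eps) :
    motionState s T ∈ maneuvering := by
  obtain ⟨hi, -, hco, H⟩ := hs
  have hw := hi.2.2.2.2.2.1
  have hw2 := mul_self_of_sign hw
  have hai : -s .c < s .w * s .ai ∧ s .w * s .ai < s .c := by
    rw [hco] at hlo hup
    rcases hw with hw | hw <;> rw [hw] <;> constructor <;> linarith
  refine ⟨hi, ht, hco, H.imp (fun h => ⟨h.1, ?_⟩) fun h => ⟨h.1, ?_⟩⟩
  · have hd : s .alo ≤ s .w * (s .ao - s .ai) := by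
      rw [h.1]
      linear_combination hai.2 - (s .alo + s .c) * hw2
    exact h.2.motion hT hd
  · have hd : s .w * (s .ao - s .ai) ≤ 0 := by
      rw [h.1]
      linear_combination hai.1 - s .c * hw2
    have := h.2.motion hT hd
    rw [sub_sub (s .eps)] at this
    exact this

lemma maneuvering_subset_motion :
    maneuvering ⊆ demonWins (.seq intruder motion) maneuvering := by
  intro s hs a ha
  -- `maneuvering` does not mention `ai`.
  have hs' : Function.update s .ai a ∈ maneuvering := hs
  have key : ∀ Q : Formula, Q ⊆ {s | s .t ≤ s .eps} →
      Function.update s .ai a ∈ demonWins (.ode motionField Q) maneuvering := by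
    intro Q hQ T φ hT H
    have h1 := hQ (H.2 T (Set.right_mem_Icc.2 hT)).2
    rw [H.eq_motionState hT] at h1 ⊢
    exact maneuvering_motionState hT hs' ha.1 ha.2 h1
  exact ⟨key _ fun _ h => h.1, key _ fun _ h => h.1, key _ fun _ h => h.1⟩

/-! ### Rules for winning regions -/

lemma subset_demonWins_loop {α : Game} {X Z : Set State} (hX : Z ⊆ X) (hZ : Z ⊆ demonWins α Z) :
    Z ⊆ demonWins (.loop α) X :=
  Set.subset_sUnion_of_mem (Set.subset_inter hX hZ)

lemma demonWins_mono (α : Game) : ∀ {X Y : Set State}, X ⊆ Y → demonWins α X ⊆ demonWins α Y := by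
  induction α with
  | assign x e => exact fun h s hs => h hs
  | assignAny x => exact fun h s hs a => h (hs a)
  | test Q => exact fun h s hs hq => h (hs hq)
  | ode f Q => exact fun h s hs T φ hT hφ => h (hs T φ hT hφ)
  | choice α β iα iβ => exact fun h => Set.inter_subset_inter (iα h) (iβ h)
  | seq α β iα iβ => exact fun h => iα (iβ h)
  | loop α iα =>
    exact fun h => Set.sUnion_subset_sUnion fun Z hZ => hZ.trans (Set.inter_subset_inter_left _ h)
  | dual α iα => exact fun h => Set.compl_subset_compl.2 (iα (Set.compl_subset_compl.2 h))

lemma mem_demonWins_dual_assignAny_test {x : Var} {Q : Formula} {X : Set State} {s : State}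
    (a : ℝ) (hQ : Function.update s x a ∈ Q) (hX : Function.update s x a ∈ X) :
    s ∈ demonWins (.dual (.seq (.assignAny x) (.test Q))) X :=
  fun h => h a hQ hX

/-- The ownship wins with any pair of games that allow the estimate `co = c` and the accelerations
`w * (alo + c)` and `-(w * c)`. -/
lemma encounter_wins {E O : Formula}
    (hE : ∀ s ∈ init, Function.update s .co (s .c) ∈ E)
    (hlo : ∀ s ∈ init, Function.update s .ao (s .w * (s .alo + s .c)) ∈ O)
    (hup : ∀ s ∈ init, Function.update s .ao (-(s .w * s .c)) ∈ O) :
    init ∩ safeable ⊆ demonWins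
      (encounter (.dual (.assignAny .co ;; .test E)) (.dual (.assignAny .ao ;; .test O)))
      (notNMAC ∩ followUp) := by
  -- The estimate is fixed outside this loop, so `co = c` must be part of its invariant.
  have hO : maneuverSafe ∩ {s | s .co = s .c} ⊆
      demonWins (.seq (.dual (.assignAny .ao ;; .test O)) (.loop (intruder ;; motion)))
        (maneuverSafe ∩ {s | s .co = s .c}) := by
    rintro s ⟨⟨hi, ht, H⟩, hco⟩
    have hsub : maneuvering ⊆
        demonWins (.loop (intruder ;; motion)) (maneuverSafe ∩ {s | s .co = s .c}) := by
      refine subset_demonWins_loop ?_ maneuvering_subset_motion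
      rintro s ⟨hi, ht, hco, H⟩
      exact ⟨⟨hi, ht, H.imp And.right And.right⟩, hco⟩
    -- The strategy: play the acceleration that preserves whichever condition holds.
    rcases H with H | H
    · exact mem_demonWins_dual_assignAny_test _ (hlo s hi)
        (hsub ⟨hi, ht, hco, .inl ⟨rfl, H⟩⟩)
    · exact mem_demonWins_dual_assignAny_test _ (hup s hi)
        (hsub ⟨hi, ht, hco, .inr ⟨rfl, H⟩⟩)
  have hM : maneuverSafe ⊆ demonWins (.seq (.dual (.assignAny .co ;; .test E))
      (.loop ((.dual (.assignAny .ao ;; .test O)) ;; .loop (intruder ;; motion))))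
      maneuverSafe := fun s hs =>
    mem_demonWins_dual_assignAny_test _ (hE s hs.1)
      (subset_demonWins_loop Set.inter_subset_left hO ⟨hs, rfl⟩)
  -- The initial timer is arbitrary; it may be reset because neither the assumptions nor the goal
  -- mention `t`.
  have hinit : ∀ s ∈ init ∩ safeable, s ∈ notNMAC ∩ followUp := fun s hs =>
    (maneuverSafe_subset (maneuverSafe_of_safeable (s := Function.update s .t 0)
      hs.1 hs.2 rfl)).2
  -- The old advisory need not stay safeable, so the outer invariant omits it; the opponent's test
  -- supplies safeability of each new one.
  refine fun s hs => subset_demonWins_loop (Z := init ∩ (notNMAC ∩ followUp))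
    Set.inter_subset_right ?_ ⟨hs.1, hinit s hs⟩
  rintro s ⟨hi, -⟩
  have key : ∀ w : ℝ, (w = -1 ∨ w = 1) → Function.update s .w w ∈ demonWins
      (.assignAny .vlo ;; .assignAny .vup ;; .test safeable ;;
        .assign .advW (fun s => s .w) ;; .assign .advLo (fun s => s .vlo) ;;
        .assign .advUp (fun s => s .vup)) (demonWins (.assign .t (fun _ => 0))
      (demonWins (.loop (.dual (.assignAny .co ;; .test E) ;;
        .loop (.dual (.assignAny .ao ;; .test O) ;; .loop (intruder ;; motion))))
      (init ∩ (notNMAC ∩ followUp)))) := by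
    intro w hw vlo vup hsafe
    refine subset_demonWins_loop maneuverSafe_subset hM
      (maneuverSafe_of_safeable ?_ hsafe rfl)
    obtain ⟨h1, h2, h3, h4, h5, -, h6⟩ := hi
    exact ⟨h1, h2, h3, h4, h5, hw, h6⟩
  exact ⟨key 1 (.inr rfl), key (-1) (.inl rfl)⟩

lemma mul_mem_acceleration_range {w a m : ℝ} (hw : w = -1 ∨ w = 1) (h0 : 0 ≤ a) (h : a ≤ m) :
    -m ≤ w * a ∧ w * a ≤ m := by
  rcases hw with rfl | rfl <;> constructor <;> linarith

lemma acceleration_lo_mem_range {s : State} (hs : s ∈ init) :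
    -s .amax ≤ s .w * (s .alo + s .c) ∧ s .w * (s .alo + s .c) ≤ s .amax := by
  obtain ⟨-, -, -, hc, ha, hw, -, hm, -⟩ := hs
  exact mul_mem_acceleration_range hw (by linarith) (by linarith)

lemma acceleration_up_mem_range {s : State} (hs : s ∈ init) :
    -s .amax ≤ -(s .w * s .c) ∧ -(s .w * s .c) ≤ s .amax := by
  obtain ⟨-, -, -, hc, ha, hw, -, hm, -⟩ := hs
  have := mul_mem_acceleration_range (m := s .amax) hw hc.le (by linarith)
  constructor <;> linarith

end ACASX

theorem theorem7 :
    ACASX.Valid ACASX.safeableVert ∧ ACASX.Valid ACASX.safeableVertStrategic := by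
  constructor
  · intro s hs
    -- The first claim needs only half of the objective.
    refine ACASX.demonWins_mono _ Set.inter_subset_left (ACASX.encounter_wins ?_ ?_ ?_ hs)
    · exact fun s hs => hs.2.2.2.1.le
    · exact fun s hs => ACASX.acceleration_lo_mem_range hs
    · exact fun s hs => ACASX.acceleration_up_mem_range hs
  · intro s hs
    refine ACASX.encounter_wins ?_ ?_ ?_ hs
    · exact fun s hs => ⟨hs.2.2.2.1.le, rfl⟩
    · exact fun s hs => ⟨ACASX.acceleration_lo_mem_range hs, .inl rfl⟩
    · exact fun s hs => ⟨ACASX.acceleration_up_mem_range hs, .inr (.inr rfl)⟩
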